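/- For a set $A$ and an infinite cardinal $\kappa$, let $\mathcal P_\kappa A=\{x\subset A:|x|<\kappa\}$; cardinals are identified with initial ordinals. A set $X\subset\mathcal P_\kappa A$ is unbounded in $\mathcal P_\kappa A$ if every $a\in\mathcal P_\kappa A$ is included in some $x\in X$; it is club if it is unbounded and closed under unions of nonempty $\subset$-chains of length less than $\kappa$; and $S\subset\mathcal P_\kappa A$ is stationary in $\mathcal P_\kappa A$ if it meets every club subset of $\mathcal P_\kappa A$. Let $\operatorname{cov}(\lambda,\mu^+,\mu^+,\nu)$ be the least size of a family $P$ of subsets of $\lambda$, each of size at most $\mu$, such that every subset of $\lambda$ of size at most $\mu$ is included in the union of fewer than $\nu$ members of $P$. **Theorem 3.** Let $\nu<\kappa$ be regular uncountable cardinals and let $\mu<\lambda$ be cardinals with $\kappa\le\mu$. Assume that $\operatorname{cov}(\lambda,\mu^+,\mu^+,\nu)=\lambda$, that $\{c_\xi:\xi<\mu\}\subset\mathcal P_\nu\mu$, and that $T$ is a stationary subset of $\mathcal P_\kappa\mu$ of size $\mu$ such that for every $z\in T$ the set $\{c_\xi:\xi\in z\}$ is an unbounded subset of $\mathcal P_\nu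 z$. Then $\mathcal P_\kappa\lambda$ has a $\mu$-nonreflecting stationary subset, that is, there is a stationary subset $S$ of $\mathcal P_\kappa\lambda$ such that $S\cap\mathcal P_\kappa A$ is nonstationary in $\mathcal P_\kappa A$ for every $A$ with $\mu\subset A\subset\lambda$ and $|A|=\mu$. -/

import Mathlib

universe u

open Cardinal Set

/-- `SmallSubsets κ A` is `P_κ A`, the family of subsets of `A` of size less than `κ`, for a set `A`
of ordinals. A cardinal `μ` is identified with the set `Iio μ.ord` of ordinals below it. -/
def SmallSubsets (κ : Cardinal.{u}) (A : Set Ordinal.{u}) : Set (Set Ordinal.{u}) :=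
  {x | x ⊆ A ∧ #x < Cardinal.lift.{u + 1} κ}

/-- `X` is an unbounded subset of the family `P` of sets, ordered by inclusion. -/
def IsUnboundedIn (P X : Set (Set Ordinal.{u})) : Prop :=
  X ⊆ P ∧ ∀ a ∈ P, ∃ x ∈ X, a ⊆ x

/-- `C` is a closed unbounded subset of `P_κ A`: it is unbounded, and closed under unions of
nonempty chains of length less than `κ`. -/
def IsClubIn (κ : Cardinal.{u}) (A : Set Ordinal.{u}) (C : Set (Set Ordinal.{u})) : Prop :=
  IsUnboundedIn (SmallSubsets κ A) C ∧
    ∀ D : Set (Set Ordinal.{u}), D ⊆ C → D.Nonempty → IsChain (· ⊆ ·) D →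
      #D < Cardinal.lift.{u + 1} κ → ⋃₀ D ∈ C

/-- `S` is a stationary subset of `P_κ A`: it meets every closed unbounded subset of `P_κ A`. -/
def IsStationaryIn (κ : Cardinal.{u}) (A : Set Ordinal.{u}) (S : Set (Set Ordinal.{u})) : Prop :=
  S ⊆ SmallSubsets κ A ∧ ∀ C, IsClubIn κ A C → (S ∩ C).Nonempty

/-- `S` is a `μ`-nonreflecting stationary subset of `P_κ lam`: it is stationary, and
`S ∩ P_κ A` is nonstationary in `P_κ A` whenever `μ ⊆ A ⊆ lam` and `|A| = μ`. -/
def IsNonreflectingStationary (κ μ lam : Cardinal.{u}) (S : Set (Set Ordinal.{u})) : Prop :=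
  IsStationaryIn κ (Iio lam.ord) S ∧
    ∀ A : Set Ordinal.{u}, Iio μ.ord ⊆ A → A ⊆ Iio lam.ord → #A = Cardinal.lift.{u + 1} μ →
      ¬ IsStationaryIn κ A (S ∩ SmallSubsets κ A)

/-- The covering number `cov(lam, μ, θ, σ)`: the least size of a family `P` of subsets of `lam` of
size less than `μ` such that every subset of `lam` of size less than `θ` is included in the union of
fewer than `σ` members of `P`. -/
noncomputable def covNumber (lam μ θ σ : Cardinal.{u}) : Cardinal.{u} :=
  sInf {k | ∃ P : Set (Set Ordinal.{u}), #P = Cardinal.lift.{u + 1} k ∧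
    P ⊆ SmallSubsets μ (Iio lam.ord) ∧
    ∀ t ∈ SmallSubsets θ (Iio lam.ord), ∃ Q ⊆ P, #Q < Cardinal.lift.{u + 1} σ ∧ t ⊆ ⋃₀ Q}

-- Index the cover as `P a` for `a < lam`, with injections `g a` of `P a` into `μ` and a canonical
-- cover `Q B` by fewer than `ν` indices for each `B` of size at most `μ`. The witness
-- `nonreflecting κ T` asks that fewer than `ν` indices in `x` already generate `D.union x`, and
-- that `x` is not `Captured`.
--
-- Nonreflection: let `A` have size `μ` and fix a bijection with `μ`. Since the sets `c ξ` with `ξ ∈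
-- x ∩ μ` are unbounded in `P_ν (x ∩ μ)`, one of them catches the preimages of the generating
-- indices. Thus `D.union x` is one of `μ` sets `B ξ`, with `ξ ∈ x`. Club many `x` are closed under
-- the coding functions attached to `Q (B ξ)`, and this makes `x` captured.
--
-- Stationarity: a club contains all small sets closed under some `G`. For `z ∈ T`, consider a game
-- in which sets of size at most `μ` must be covered by enlarging an index set without the
-- `G`-closure adding points of `μ` to `z`. As `T` has size `μ`, one run answers the strategies for
-- all `z` at once, and stationarity of `T` makes it legal for some `z` (`exists_undefeated`). Two
-- interleaved sequences of undefeated positions then produce closed sets `x`, `y` with the same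
-- intersection `z` with `μ` and the same union, hence the same canonical cover. They are steered so
-- that some `a ∈ x` lies in `P b` with `b ∈ y` but `g b a ∉ z`. If both were captured, the common
-- trace would force `g b a ∈ z`; so one of them is in the witness.

universe v

/-! ### Closure under set-valued functions of finite sets -/

section Closure

variable {α : Type v}

/-- `x` is closed under the set-valued function `G` of finite sets. -/
def FinClosed (G : Finset α → Set α) (x : Set α) : Prop :=
  ∀ e : Finset α, (e : Set α) ⊆ x → G e ⊆ x

/-- The least superset of `X` closed under `G`. -/
def finClosure (G : Finset α → Set α) (X : Set α) : Set α :=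
  ⋂₀ {x | X ⊆ x ∧ FinClosed G x}

theorem subset_finClosure (G : Finset α → Set α) (X : Set α) : X ⊆ finClosure G X :=
  subset_sInter fun _ h => h.1

theorem finClosed_finClosure (G : Finset α → Set α) (X : Set α) :
    FinClosed G (finClosure G X) := fun e he =>
  subset_sInter fun _ hx => hx.2 e (he.trans (sInter_subset_of_mem hx))

theorem finClosure_subset {G : Finset α → Set α} {X x : Set α} (h : X ⊆ x) (hx : FinClosed G x) :
    finClosure G X ⊆ x :=
  sInter_subset_of_mem ⟨h, hx⟩

theorem finClosure_mono (G : Finset α → Set α) {X Y : Set α} (h : X ⊆ Y) :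
    finClosure G X ⊆ finClosure G Y :=
  finClosure_subset (h.trans (subset_finClosure G Y)) (finClosed_finClosure G Y)

theorem finClosed_iUnion {ι : Type*} [Nonempty ι] {G : Finset α → Set α} {x : ι → Set α}
    (hd : Directed (· ⊆ ·) x) (hx : ∀ i, FinClosed G (x i)) : FinClosed G (⋃ i, x i) := by
  intro e he
  obtain ⟨i, hi⟩ := hd.exists_mem_subset_of_finset_subset_biUnion he
  exact (hx i e hi).trans (subset_iUnion x i)

theorem finClosure_iUnion_subset {ι : Type*} [Nonempty ι] (G : Finset α → Set α) {X : ι → Set α}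
    (hd : Directed (· ⊆ ·) X) : finClosure G (⋃ i, X i) ⊆ ⋃ i, finClosure G (X i) := by
  refine finClosure_subset (iUnion_mono fun i => subset_finClosure G _)
    (finClosed_iUnion (fun i j => ?_) fun i => finClosed_finClosure G _)
  obtain ⟨k, hik, hjk⟩ := hd i j
  exact ⟨k, finClosure_mono G hik, finClosure_mono G hjk⟩

theorem mk_iUnion_nat_lt {c : Cardinal.{v}} (hc : c.IsRegular) (hc' : ℵ₀ < c) {t : ℕ → Set α}
    (ht : ∀ n, #(t n) < c) : #(⋃ n, t n) < c := by
  have h : (⋃ n, t n) = ⋃ n : ULift.{v} ℕ, t n.down := by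
    ext a; simp
  rw [h, card_iUnion_lt_iff_forall_of_isRegular hc (by simpa using hc')]
  exact fun n => ht n.down

theorem mk_finset_lt {c : Cardinal.{v}} (hc : ℵ₀ ≤ c) {β : Type v} (h : #β < c) :
    #(Finset β) < c := by
  cases finite_or_infinite β
  · exact (lt_aleph0_of_finite _).trans_le hc
  · rwa [mk_finset_of_infinite]

theorem mk_finset_subset_lt {c : Cardinal.{v}} (hc : ℵ₀ ≤ c) {X : Set α} (h : #X < c) :
    #{e : Finset α | (e : Set α) ⊆ X} < c := by
  refine lt_of_le_of_lt ?_ (mk_finset_lt hc h)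
  refine mk_le_of_surjective (f := fun e : Finset X => ⟨e.map (Function.Embedding.subtype _), ?_⟩) ?_
  · intro a ha
    simp only [Finset.coe_map, Function.Embedding.subtype_apply, mem_image] at ha
    obtain ⟨b, -, rfl⟩ := ha
    exact b.2
  · rintro ⟨e, he⟩
    classical
    refine ⟨e.subtype (· ∈ X), Subtype.ext ?_⟩
    exact Finset.subtype_map_of_mem fun a ha => he ha

/-- Countably many rounds of adding values suffice, because a finite subset of the increasing union
already lies in one stage. -/
theorem mk_finClosure_lt {c : Cardinal.{v}} (hc : c.IsRegular) (hc' : ℵ₀ < c)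
    {G : Finset α → Set α} (hG : ∀ e, #(G e) < c) {X : Set α} (hX : #X < c) :
    #(finClosure G X) < c := by
  let s : Set α → Set α := fun Y => Y ∪ ⋃ e ∈ {e : Finset α | (e : Set α) ⊆ Y}, G e
  let Y : ℕ → Set α := fun n => s^[n] X
  have hY : ∀ n, Y (n + 1) = s (Y n) := fun n => Function.iterate_succ_apply' s n X
  have hmono : Monotone Y := monotone_nat_of_le_succ fun n => by
    rw [hY]; exact subset_union_left
  have hcard : ∀ n, #(Y n) < c := by
    intro n
    induction n with
    | zero => exact hX
    | succ n ih =>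
      rw [hY]
      refine (mk_union_le _ _).trans_lt (add_lt_of_lt hc.aleph0_le ih ?_)
      exact (card_biUnion_lt_iff_forall_of_isRegular hc
        (mk_finset_subset_lt hc.aleph0_le ih)).2 fun e _ => hG e
  refine (mk_le_mk_of_subset ?_).trans_lt (mk_iUnion_nat_lt hc hc' hcard)
  refine finClosure_subset (subset_iUnion Y 0) fun e he => ?_
  obtain ⟨n, hn⟩ := hmono.directed_le.exists_mem_subset_of_finset_subset_biUnion he
  refine subset_trans ?_ (subset_iUnion Y (n + 1))
  rw [hY]
  exact (subset_biUnion_of_mem (u := fun e => G e) hn).trans subset_union_right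

/-- An infinite set is the union of a chain of subsets of smaller size. -/
theorem exists_total_iUnion_eq_univ (β : Type v) [Infinite β] :
    ∃ Y : β → Set β, (∀ a b, Y a ⊆ Y b ∨ Y b ⊆ Y a) ∧ (∀ a, #(Y a) < #β) ∧ ⋃ a, Y a = Set.univ := by
  obtain ⟨_, _, hβ⟩ := exists_ord_eq_type_lt β
  refine ⟨Iio, fun a b => ?_, fun a => mk_Iio_lt a hβ, eq_univ_of_forall fun b => ?_⟩
  · exact (le_total a b).imp (fun h => Iio_subset_Iio h) fun h => Iio_subset_Iio h
  · by_contra hcon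
    have htop : ∀ a : β, a ≤ b := fun a => not_lt.1 fun h => hcon (mem_iUnion.2 ⟨a, h⟩)
    have h1 : (Set.univ : Set β) ⊆ Iio b ∪ {b} := fun a _ => by
      rcases (htop a).lt_or_eq with h | h
      · exact Or.inl h
      · exact Or.inr h
    have h2 : #β ≤ #(Iio b) + 1 := by
      rw [← mk_univ]
      refine (mk_le_mk_of_subset h1).trans ((mk_union_le _ _).trans ?_)
      simp
    have h4 : ℵ₀ ≤ #β := aleph0_le_mk β
    exact absurd h2 (not_le.2 (add_lt_of_lt h4 (mk_Iio_lt b hβ) (one_lt_aleph0.trans_le h4)))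

end Closure

/-! ### Clubs contain the small sets closed under a function -/

section Club

variable {κ : Cardinal.{u}} {A : Set Ordinal.{u}}

theorem isClubIn_finClosed (hκ : κ.IsRegular) (hκ' : ℵ₀ < κ)
    {G : Finset Ordinal.{u} → Set Ordinal.{u}} (hG : ∀ e, G e ⊆ A)
    (hGc : ∀ e, #(G e) < Cardinal.lift.{u + 1} κ) :
    IsClubIn κ A {x | x ∈ SmallSubsets κ A ∧ FinClosed G x} := by
  have hK := hκ.lift.{u + 1}
  have hK' : ℵ₀ < Cardinal.lift.{u + 1} κ := by simpa using hκ'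
  refine ⟨⟨fun x hx => hx.1, fun a ha => ⟨finClosure G a, ⟨⟨?_, ?_⟩, ?_⟩, subset_finClosure G a⟩⟩,
    fun D hD hne hch hDc => ⟨⟨sUnion_subset fun d hd => (hD hd).1.1, ?_⟩, ?_⟩⟩
  · exact finClosure_subset ha.1 fun e _ => hG e
  · exact mk_finClosure_lt hK hK' hGc ha.2
  · exact finClosed_finClosure G a
  · rw [sUnion_eq_iUnion, card_iUnion_lt_iff_forall_of_isRegular hK hDc]
    exact fun d => (hD d.2).1.2
  · rw [sUnion_eq_iUnion]
    have := hne.to_subtype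
    exact finClosed_iUnion hch.directedOn.directed_val fun d => (hD d.2).2

/-- Recursion along proper inclusion: `e` and the finitely many values at its proper subsets
together form a set of size less than `κ`, which unboundedness covers. -/
theorem exists_monotone_finset_map {C : Set (Set Ordinal.{u})}
    (hκ : κ.IsRegular) (hC : IsUnboundedIn (SmallSubsets κ A) C) :
    ∃ G : Finset Ordinal.{u} → Set Ordinal.{u}, (∀ e : Finset Ordinal.{u}, (e : Set Ordinal.{u}) ⊆ A →
      G e ∈ C ∧ (e : Set Ordinal.{u}) ⊆ G e ∧ ∀ t ⊆ e, G t ⊆ G e) := by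
  have hK := hκ.lift.{u + 1}
  have hcover : ∀ a : Set Ordinal.{u}, ∃ x, a ∈ SmallSubsets κ A → x ∈ C ∧ a ⊆ x := fun a => by
    by_cases h : a ∈ SmallSubsets κ A
    · obtain ⟨x, hx⟩ := hC.2 a h
      exact ⟨x, fun _ => hx⟩
    · exact ⟨∅, fun h' => absurd h' h⟩
  choose U hU using hcover
  let G : Finset Ordinal.{u} → Set Ordinal.{u} :=
    Finset.strongInduction fun e ih => U (e ∪ ⋃ t : {t // t ⊂ e}, ih t.1 t.2)
  have hGe : ∀ e, G e = U (e ∪ ⋃ t : {t // t ⊂ e}, G t.1) := fun e =>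
    Finset.strongInduction_eq _ e
  have key : ∀ e : Finset Ordinal.{u}, (e : Set Ordinal.{u}) ⊆ A →
      G e ∈ C ∧ (e : Set Ordinal.{u}) ∪ ⋃ t : {t // t ⊂ e}, G t.1 ⊆ G e := by
    intro e
    induction e using Finset.strongInduction with
    | H e ih =>
      intro he
      have hsmall : (e : Set Ordinal.{u}) ∪ ⋃ t : {t // t ⊂ e}, G t.1 ∈ SmallSubsets κ A := by
        have hsub : ∀ t : {t // t ⊂ e}, G t.1 ∈ SmallSubsets κ A := fun t =>
          hC.1 (ih t.1 t.2 ((Finset.coe_subset.2 t.2.1).trans he)).1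
        refine ⟨union_subset he (iUnion_subset fun t => (hsub t).1), ?_⟩
        refine (mk_union_le _ _).trans_lt (add_lt_of_lt hK.aleph0_le ?_ ?_)
        · exact (lt_aleph0_of_finite _).trans_le hK.aleph0_le
        · have : Finite {t // t ⊂ e} :=
            Finite.of_injective (fun t : {t // t ⊂ e} =>
              (⟨t.1, Finset.mem_powerset.2 t.2.1⟩ : {t // t ∈ e.powerset}))
              fun a b h => Subtype.ext (by simpa using h)
          rw [card_iUnion_lt_iff_forall_of_isRegular hK
            ((lt_aleph0_of_finite _).trans_le hK.aleph0_le)]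
          exact fun t => (hsub t).2
      rw [hGe e]
      exact hU _ hsmall
  refine ⟨G, fun e he => ⟨(key e he).1, subset_union_left.trans (key e he).2, fun t ht => ?_⟩⟩
  rcases eq_or_ssubset_of_subset ht with rfl | h
  · exact subset_rfl
  · exact (subset_iUnion (fun t : {t // t ⊂ e} => G t.1) ⟨t, h⟩).trans
      (subset_union_right.trans (key e he).2)

/-- Induction on `#X`. For finite `X` the union is `G X` by monotonicity. An infinite `X` is the
union of a chain of smaller sets indexed by `X` itself, so their unions form a chain in `C` of
length less than `κ`. -/
theorem biUnion_finset_mem_of_isClubIn {C : Set (Set Ordinal.{u})} (hC : IsClubIn κ A C)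
    {G : Finset Ordinal.{u} → Set Ordinal.{u}}
    (hG : ∀ e : Finset Ordinal.{u}, (e : Set Ordinal.{u}) ⊆ A →
      G e ∈ C ∧ (e : Set Ordinal.{u}) ⊆ G e ∧ ∀ t ⊆ e, G t ⊆ G e)
    {X : Set Ordinal.{u}} (hX : X ∈ SmallSubsets κ A) :
    (⋃ e ∈ {e : Finset Ordinal.{u} | (e : Set Ordinal.{u}) ⊆ X}, G e) ∈ C := by
  suffices H : ∀ τ : Cardinal.{u + 1}, ∀ X : Set Ordinal.{u}, X ∈ SmallSubsets κ A → #X = τ →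
      (⋃ e ∈ {e : Finset Ordinal.{u} | (e : Set Ordinal.{u}) ⊆ X}, G e) ∈ C from H _ X hX rfl
  intro τ
  induction τ using WellFoundedLT.induction with
  | ind τ ih =>
  intro X hX hXτ
  rcases X.finite_or_infinite with hfin | hinf
  · obtain ⟨e, rfl⟩ := hfin.exists_finset_coe
    have : (⋃ t ∈ {t : Finset Ordinal.{u} | (t : Set Ordinal.{u}) ⊆ e}, G t) = G e := by
      refine subset_antisymm (iUnion₂_subset fun t ht => ?_) ?_
      · exact (hG e hX.1).2.2 t (Finset.coe_subset.1 ht)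
      · exact subset_biUnion_of_mem (u := fun e => G e) (mem_ofPred.2 subset_rfl)
    rw [this]
    exact (hG e hX.1).1
  · have := hinf.to_subtype
    obtain ⟨Y₀, hY₀ch, hY₀lt, hY₀U⟩ := exists_total_iUnion_eq_univ X
    let N : Set Ordinal.{u} → Set Ordinal.{u} := fun Y =>
      ⋃ e ∈ {e : Finset Ordinal.{u} | (e : Set Ordinal.{u}) ⊆ Y}, G e
    have hN : ∀ {Y Z : Set Ordinal.{u}}, Y ⊆ Z → N Y ⊆ N Z := fun h =>
      biUnion_subset_biUnion_left fun e he => subset_trans he h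
    let Y : X → Set Ordinal.{u} := fun a => Subtype.val '' Y₀ a
    have hYX : ∀ a, Y a ⊆ X := fun a => by rintro _ ⟨b, -, rfl⟩; exact b.2
    have hYch : ∀ a b, Y a ⊆ Y b ∨ Y b ⊆ Y a := fun a b =>
      (hY₀ch a b).imp (image_mono ·) (image_mono ·)
    have hYdir : Directed (· ⊆ ·) Y := fun a b => (hYch a b).elim
      (fun h => ⟨b, h, subset_rfl⟩) fun h => ⟨a, subset_rfl, h⟩
    have hYlt : ∀ a, #(Y a) < #X := fun a => by
      rw [mk_image_eq Subtype.val_injective]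
      exact hY₀lt a
    have hXU : X = ⋃ a, Y a := by
      rw [← image_iUnion, hY₀U, image_univ, Subtype.range_val]
    have hNX : N X = ⋃₀ range fun a => N (Y a) := by
      refine subset_antisymm (iUnion₂_subset fun e he => ?_) ?_
      · have he' : (e : Set Ordinal.{u}) ⊆ ⋃ a, Y a := hXU ▸ he
        obtain ⟨a, ha⟩ := hYdir.exists_mem_subset_of_finset_subset_biUnion he'
        exact (subset_biUnion_of_mem (u := fun e => G e) ha).trans
          (subset_sUnion_of_mem (mem_range_self a))
      · exact sUnion_subset (by rintro _ ⟨a, rfl⟩; exact hN (hYX a))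
    change N X ∈ C
    rw [hNX]
    refine hC.2 _ ?_ (range_nonempty _) ?_ (mk_range_le.trans_lt hX.2)
    · rintro _ ⟨a, rfl⟩
      exact ih _ (hXτ ▸ hYlt a) (Y a) ⟨(hYX a).trans hX.1, (hYlt a).trans hX.2⟩ rfl
    · rintro _ ⟨a, rfl⟩ _ ⟨b, rfl⟩ -
      exact (hYch a b).imp (hN ·) (hN ·)

/-- A closed `x` equals the union of `G e` over finite `e ⊆ x`: closure gives one inclusion and `a ∈
G {a}` the other. -/
theorem exists_finClosed_mem_of_isClubIn (hκ : κ.IsRegular) {C : Set (Set Ordinal.{u})}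
    (hC : IsClubIn κ A C) :
    ∃ G : Finset Ordinal.{u} → Set Ordinal.{u}, (∀ e, G e ⊆ A) ∧
      (∀ e, #(G e) < Cardinal.lift.{u + 1} κ) ∧
      ∀ x ∈ SmallSubsets κ A, FinClosed G x → x ∈ C := by
  classical
  obtain ⟨G, hG⟩ := exists_monotone_finset_map hκ hC.1
  let G' : Finset Ordinal.{u} → Set Ordinal.{u} := fun e =>
    if (e : Set Ordinal.{u}) ⊆ A then G e else ∅
  have hG' : ∀ e : Finset Ordinal.{u}, (e : Set Ordinal.{u}) ⊆ A → G' e = G e := fun e he => if_pos he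
  have hsmall : ∀ e, G' e ∈ SmallSubsets κ A := fun e => by
    by_cases he : (e : Set Ordinal.{u}) ⊆ A
    · rw [hG' e he]; exact hC.1.1 (hG e he).1
    · simp only [G', if_neg he]
      exact ⟨empty_subset _, by simpa using hκ.pos⟩
  refine ⟨G', fun e => (hsmall e).1, fun e => (hsmall e).2, fun x hx hxG => ?_⟩
  convert biUnion_finset_mem_of_isClubIn hC hG hx using 1
  refine subset_antisymm (fun a ha => ?_) (iUnion₂_subset fun e he => ?_)
  · have h1 : ((({a} : Finset Ordinal.{u})) : Set Ordinal.{u}) ⊆ x := by simpa using ha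
    exact mem_biUnion (x := ({a} : Finset Ordinal.{u})) h1 ((hG _ (h1.trans hx.1)).2.1 (by simp))
  · rw [← hG' e (subset_trans he hx.1)]
    exact hxG e he

end Club

/-! ### Covering systems -/

/-- A covering family `P` witnessing `cov(lam, μ⁺, μ⁺, ν) ≤ lam`, indexed by `lam`, together with
injections `g a` of its members into `μ` and a choice `Q` of fewer than `ν` covering indices. -/
structure CoverSystem (ν μ lam : Cardinal.{u}) where
  P : Ordinal.{u} → Set Ordinal.{u}
  g : Ordinal.{u} → Ordinal.{u} → Ordinal.{u}
  Q : Set Ordinal.{u} → Set Ordinal.{u}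
  P_subset : ∀ a ∈ Iio lam.ord, P a ⊆ Iio lam.ord
  mk_P_le : ∀ a ∈ Iio lam.ord, #(P a) ≤ Cardinal.lift.{u + 1, u} μ
  g_mem : ∀ a ∈ Iio lam.ord, ∀ b ∈ P a, g a b ∈ Iio μ.ord
  g_injOn : ∀ a ∈ Iio lam.ord, InjOn (g a) (P a)
  Q_subset : ∀ B, Q B ⊆ Iio lam.ord
  mk_Q_lt : ∀ B, #(Q B) < Cardinal.lift.{u + 1, u} ν
  subset_Q : ∀ B ⊆ Iio lam.ord, #B ≤ Cardinal.lift.{u + 1, u} μ → B ⊆ ⋃ a ∈ Q B, P a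

theorem nonempty_coverSystem {ν μ lam : Cardinal.{u}} (hν : 0 < ν) (hlam : 0 < lam)
    (hcov : covNumber lam (Order.succ μ) (Order.succ μ) ν = lam) :
    Nonempty (CoverSystem ν μ lam) := by
  classical
  have hlt : ∀ {A : Set Ordinal.{u}}, #A < Cardinal.lift.{u + 1, u} (Order.succ μ) ↔
      #A ≤ Cardinal.lift.{u + 1, u} μ := by
    intro A; rw [lift_succ, Order.lt_succ_iff]
  have hmem := csInf_mem (s := {k | ∃ P : Set (Set Ordinal.{u}), #P = Cardinal.lift.{u + 1, u} k ∧
    P ⊆ SmallSubsets (Order.succ μ) (Iio lam.ord) ∧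
    ∀ t ∈ SmallSubsets (Order.succ μ) (Iio lam.ord),
      ∃ Q ⊆ P, #Q < Cardinal.lift.{u + 1, u} ν ∧ t ⊆ ⋃₀ Q}) (by
    -- With no candidate the infimum would be `0`, which is not `lam`.
    by_contra h
    rw [not_nonempty_iff_eq_empty] at h
    rw [covNumber, h, Cardinal.sInf_empty] at hcov
    exact hlam.ne hcov)
  change covNumber _ _ _ _ ∈ _ at hmem
  rw [hcov] at hmem
  obtain ⟨P, hPcard, hPs, hPcov⟩ := hmem
  have hPm : #P = #(Iio lam.ord) := by rw [hPcard, mk_Iio_ordinal, card_ord]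
  obtain ⟨φ⟩ := Cardinal.eq.1 hPm
  let p : Ordinal.{u} → Set Ordinal.{u} := fun a =>
    if h : a ∈ Iio lam.ord then (φ.symm ⟨a, h⟩ : Set Ordinal.{u}) else ∅
  have hp : ∀ X : P, p (φ X) = X := fun X => by
    simp only [p, dif_pos (φ X).2]
    simp
  have hpm : ∀ a ∈ Iio lam.ord, p a ∈ P := fun a ha => by
    simp only [p, dif_pos ha]
    exact (φ.symm ⟨a, ha⟩).2
  have hg : ∀ a, ∃ g : Ordinal.{u} → Ordinal.{u}, a ∈ Iio lam.ord →
      (∀ b ∈ p a, g b ∈ Iio μ.ord) ∧ InjOn g (p a) := fun a => by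
    by_cases ha : a ∈ Iio lam.ord
    · have h1 := hlt.1 (hPs (hpm a ha)).2
      have h2 : #(p a) ≤ #(Iio μ.ord) := by rwa [mk_Iio_ordinal, card_ord]
      obtain ⟨i⟩ := h2
      refine ⟨fun b => if h : b ∈ p a then i ⟨b, h⟩ else 0, fun _ => ⟨fun b hb => ?_, ?_⟩⟩
      · simp only [dif_pos hb]
        exact (i ⟨b, hb⟩).2
      · intro b hb b' hb' h
        simp only [dif_pos hb, dif_pos hb'] at h
        simpa using i.injective (Subtype.ext h)
    · exact ⟨id, fun h => absurd h ha⟩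
  choose g hg using hg
  have hQ : ∀ B, ∃ Q : Set Ordinal.{u}, Q ⊆ Iio lam.ord ∧ #Q < Cardinal.lift.{u + 1, u} ν ∧
      (B ⊆ Iio lam.ord → #B ≤ Cardinal.lift.{u + 1, u} μ → B ⊆ ⋃ a ∈ Q, p a) := fun B => by
    by_cases hB : B ⊆ Iio lam.ord ∧ #B ≤ Cardinal.lift.{u + 1, u} μ
    · obtain ⟨R, hRP, hRc, hBR⟩ := hPcov B ⟨hB.1, hlt.2 hB.2⟩
      refine ⟨range fun X : R => (φ ⟨X, hRP X.2⟩ : Ordinal.{u}), ?_, mk_range_le.trans_lt hRc,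
        fun _ _ b hb => ?_⟩
      · rintro _ ⟨X, rfl⟩
        exact (φ ⟨X, hRP X.2⟩).2
      · obtain ⟨X, hX, hbX⟩ := hBR hb
        refine mem_biUnion (mem_range_self ⟨X, hX⟩) ?_
        rw [hp]
        exact hbX
    · exact ⟨∅, empty_subset _, by simpa using hν, fun h1 h2 => absurd ⟨h1, h2⟩ hB⟩
  choose Q hQ using hQ
  exact ⟨⟨p, g, Q, fun a ha => (hPs (hpm a ha)).1, fun a ha => hlt.1 (hPs (hpm a ha)).2,
    fun a ha => (hg a ha).1, fun a ha => (hg a ha).2, fun B => (hQ B).1, fun B => (hQ B).2.1,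
    fun B => (hQ B).2.2⟩⟩

/-! ### The candidate set and its nonreflection -/

namespace CoverSystem

variable {ν μ lam : Cardinal.{u}} (D : CoverSystem ν μ lam)

/-- The union of the members of the covering family with index in `x`. -/
def union (x : Set Ordinal.{u}) : Set Ordinal.{u} := ⋃ a ∈ x, D.P a

/-- The elements of members with index in `Q` whose code is in `z`. -/
def trace (Q z : Set Ordinal.{u}) : Set Ordinal.{u} := {a | ∃ q ∈ Q, a ∈ D.P q ∧ D.g q a ∈ z}

/-- `x` is included in the trace of the canonical cover of `D.union x`, and this trace
has codes in `x` relative to each index in `x`. -/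
def Captured (x : Set Ordinal.{u}) : Prop :=
  x ⊆ D.trace (D.Q (D.union x)) (x ∩ Iio μ.ord) ∧
    ∀ b ∈ x, ∀ a ∈ D.trace (D.Q (D.union x)) (x ∩ Iio μ.ord), a ∈ D.P b → D.g b a ∈ x

/-- The nonreflecting set determined by a covering system and a stationary set `T`. -/
def nonreflecting (κ : Cardinal.{u}) (T : Set (Set Ordinal.{u})) : Set (Set Ordinal.{u}) :=
  {x | x ∈ SmallSubsets κ (Iio lam.ord) ∧ x ∩ Iio μ.ord ∈ T ∧
    (∃ R ⊆ x, #R < Cardinal.lift.{u + 1, u} ν ∧ D.union x = D.union R ∧ x ⊆ D.union R) ∧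
    ¬ D.Captured x}

theorem union_mono {x y : Set Ordinal.{u}} (h : x ⊆ y) : D.union x ⊆ D.union y :=
  biUnion_subset_biUnion_left h

theorem union_subset {x : Set Ordinal.{u}} (h : x ⊆ Iio lam.ord) : D.union x ⊆ Iio lam.ord :=
  iUnion₂_subset fun a ha => D.P_subset a (h ha)

theorem mk_union_le (hμ : ℵ₀ ≤ μ) {x : Set Ordinal.{u}} (h : x ⊆ Iio lam.ord)
    (hx : #x ≤ Cardinal.lift.{u + 1, u} μ) : #(D.union x) ≤ Cardinal.lift.{u + 1, u} μ := by
  rw [← Order.lt_succ_iff] at hx ⊢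
  refine (card_biUnion_lt_iff_forall_of_isRegular (isRegular_succ ?_) hx).2 fun a ha => ?_
  · simpa using hμ
  · exact Order.lt_succ_iff.2 (D.mk_P_le a (h ha))

theorem mk_trace_lt {κ : Cardinal.{u}} (hκ : κ.IsRegular) {Q z : Set Ordinal.{u}}
    (hQ : Q ⊆ Iio lam.ord) (hQc : #Q < Cardinal.lift.{u + 1, u} κ)
    (hz : #z < Cardinal.lift.{u + 1, u} κ) : #(D.trace Q z) < Cardinal.lift.{u + 1, u} κ := by
  have : D.trace Q z = ⋃ q ∈ Q, {a | a ∈ D.P q ∧ D.g q a ∈ z} := by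
    ext a; simp [trace, and_left_comm]
  rw [this]
  refine (card_biUnion_lt_iff_forall_of_isRegular hκ.lift hQc).2 fun q hq => ?_
  refine lt_of_le_of_lt ?_ hz
  have hinj : InjOn (D.g q) {a | a ∈ D.P q ∧ D.g q a ∈ z} :=
    (D.g_injOn q (hQ hq)).mono fun a ha => ha.1
  rw [← mk_image_eq_of_injOn _ _ hinj]
  exact mk_le_mk_of_subset (by rintro _ ⟨a, ha, rfl⟩; exact ha.2)

theorem not_isStationaryIn_nonreflecting {κ : Cardinal.{u}} (hκ : κ.IsRegular) (hκ' : ℵ₀ < κ)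
    (hνκ : ν < κ) (hκμ : κ ≤ μ) {c : Ordinal.{u} → Set Ordinal.{u}} {T : Set (Set Ordinal.{u})}
    (hTc : ∀ z ∈ T, IsUnboundedIn (SmallSubsets ν z) (c '' z))
    {A : Set Ordinal.{u}} (hμA : Iio μ.ord ⊆ A) (hA : A ⊆ Iio lam.ord)
    (hAc : #A = Cardinal.lift.{u + 1, u} μ) :
    ¬ IsStationaryIn κ A (D.nonreflecting κ T ∩ SmallSubsets κ A) := by
  classical
  intro hS
  have hK : (Cardinal.lift.{u + 1, u} κ).IsRegular := hκ.lift
  obtain ⟨φ⟩ : Nonempty (Iio μ.ord ≃ A) :=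
    Cardinal.eq.1 (by rw [hAc, mk_Iio_ordinal, card_ord])
  let f : Ordinal.{u} → Ordinal.{u} := fun ξ => if h : ξ ∈ Iio μ.ord then φ ⟨ξ, h⟩ else 0
  let f' : Ordinal.{u} → Ordinal.{u} := fun a => if h : a ∈ A then φ.symm ⟨a, h⟩ else 0
  have hf : ∀ ξ ∈ Iio μ.ord, f ξ ∈ A := fun ξ hξ => by
    simp only [f, dif_pos hξ]; exact (φ ⟨ξ, hξ⟩).2
  have hf' : ∀ a ∈ A, f' a ∈ Iio μ.ord := fun a ha => by
    simp only [f', dif_pos ha]; exact (φ.symm ⟨a, ha⟩).2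
  have hff' : ∀ a ∈ A, f (f' a) = a := fun a ha => by
    simp only [f, dif_pos (hf' a ha)]
    simp [f', dif_pos ha]
  let B : Ordinal.{u} → Set Ordinal.{u} := fun ξ => D.union (f '' c ξ)
  have hpick : ∀ ξ, ∃ a, ¬ A ⊆ B ξ → a ∈ A ∧ a ∉ B ξ := fun ξ => by
    by_cases h : A ⊆ B ξ
    · exact ⟨0, fun h' => absurd h h'⟩
    · obtain ⟨a, ha⟩ := not_subset.1 h
      exact ⟨a, fun _ => ha⟩
  choose pick hpick using hpick
  -- The first part gives the bijection, its inverse and a witness to `¬ A ⊆ B ξ`. The other two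
  -- serve the two clauses of `Captured`: codes of `β`, and the translation of a code `η` relative
  -- to `q` into a code relative to `β`.
  let F : Ordinal.{u} → Ordinal.{u} → Ordinal.{u} → Set Ordinal.{u} := fun ξ β η =>
    {f ξ, f' β, pick ξ} ∪ ((fun q => D.g q β) '' D.Q (B ξ) ∪
      {w | ∃ q ∈ D.Q (B ξ), ∃ a, a ∈ D.P q ∧ a ∈ D.P β ∧ D.g q a = η ∧ D.g β a = w})
  have hQκ : ∀ ξ, #(D.Q (B ξ)) < Cardinal.lift.{u + 1, u} κ := fun ξ =>
    (D.mk_Q_lt _).trans (lift_lt.2 hνκ)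
  have hF : ∀ ξ β η, #(F ξ β η) < Cardinal.lift.{u + 1, u} κ := fun ξ β η => by
    refine (Cardinal.mk_union_le _ _).trans_lt (add_lt_of_lt hK.aleph0_le ?_
      ((Cardinal.mk_union_le _ _).trans_lt (add_lt_of_lt hK.aleph0_le ?_ ?_)))
    · exact (lt_aleph0_of_finite _).trans_le hK.aleph0_le
    · exact mk_image_le.trans_lt (hQκ ξ)
    -- By injectivity of `D.g q`, each `q` contributes at most one value.
    · refine lt_of_le_of_lt (mk_le_mk_of_subset ?_)
        ((mk_image_le (f := fun q => D.g β (Function.invFunOn (D.g q) (D.P q) η))).trans_lt (hQκ ξ))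
      rintro w ⟨q, hq, a, haq, -, hη, rfl⟩
      refine ⟨q, hq, ?_⟩
      have hex : ∃ a ∈ D.P q, D.g q a = η := ⟨a, haq, hη⟩
      have := D.g_injOn q (D.Q_subset _ hq) (Function.invFunOn_mem hex) haq
        ((Function.invFunOn_eq hex).trans hη.symm)
      simp only [this]
  -- Intersecting with `A` discards junk, such as `D.g q β` for `β ∉ D.P q`.
  let G : Finset Ordinal.{u} → Set Ordinal.{u} := fun e =>
    ⋃ ξ ∈ (e : Set Ordinal.{u}), ⋃ β ∈ (e : Set Ordinal.{u}), ⋃ η ∈ (e : Set Ordinal.{u}),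
      F ξ β η ∩ A
  have hfin : ∀ e : Finset Ordinal.{u}, #(e : Set Ordinal.{u}) < Cardinal.lift.{u + 1, u} κ :=
    fun e => (lt_aleph0_of_finite _).trans_le hK.aleph0_le
  have hGA : ∀ e, G e ⊆ A := fun e => iUnion₂_subset fun _ _ => iUnion₂_subset fun _ _ =>
    iUnion₂_subset fun _ _ => inter_subset_right
  have hGc : ∀ e, #(G e) < Cardinal.lift.{u + 1, u} κ := fun e => by
    refine (card_biUnion_lt_iff_forall_of_isRegular hK (hfin e)).2 fun ξ _ => ?_
    refine (card_biUnion_lt_iff_forall_of_isRegular hK (hfin e)).2 fun β _ => ?_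
    refine (card_biUnion_lt_iff_forall_of_isRegular hK (hfin e)).2 fun η _ => ?_
    exact (mk_le_mk_of_subset inter_subset_left).trans_lt (hF ξ β η)
  obtain ⟨x, ⟨⟨⟨-, hxT, ⟨R, hRx, hRc, hxR, hxsub⟩, hcap⟩, hxA⟩, -, hxG⟩⟩ :=
    hS.2 _ (isClubIn_finClosed hκ hκ' hGA hGc)
  have hcl : ∀ ξ ∈ x, ∀ β ∈ x, ∀ η ∈ x, ∀ w ∈ F ξ β η, w ∈ A → w ∈ x := by
    intro ξ hξ β hβ η hη w hw hwA
    refine hxG {ξ, β, η} ?_ (mem_biUnion (x := ξ) (by simp)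
      (mem_biUnion (x := β) (by simp) (mem_biUnion (x := η) (by simp) ⟨hw, hwA⟩)))
    intro a ha
    simp only [Finset.coe_insert, Finset.coe_singleton, mem_insert_iff, mem_singleton_iff] at ha
    rcases ha with rfl | rfl | rfl <;> assumption
  have hf'x : ∀ a ∈ x, f' a ∈ x := fun a ha =>
    hcl a ha a ha a ha _ (Or.inl (by simp)) (hμA (hf' a (hxA.1 ha)))
  have hfx : ∀ ξ ∈ x ∩ Iio μ.ord, f ξ ∈ x := fun ξ hξ =>
    hcl ξ hξ.1 ξ hξ.1 ξ hξ.1 _ (Or.inl (by simp)) (hf ξ hξ.2)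
  obtain ⟨_, ⟨ξ, hξ, rfl⟩, hRξ⟩ := (hTc _ hxT).2 (f' '' R) ⟨by
    rintro _ ⟨r, hr, rfl⟩
    exact ⟨hf'x r (hRx hr), hf' r (hxA.1 (hRx hr))⟩, mk_image_le.trans_lt hRc⟩
  have hcξ : c ξ ⊆ x ∩ Iio μ.ord := ((hTc _ hxT).1 (mem_image_of_mem c hξ)).1
  have hfcx : f '' c ξ ⊆ x := by
    rintro _ ⟨η, hη, rfl⟩
    exact hfx η (hcξ hη)
  have hRf : R ⊆ f '' c ξ := fun r hr =>
    ⟨f' r, hRξ (mem_image_of_mem f' hr), hff' r (hxA.1 (hRx hr))⟩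
  -- `f '' c ξ` is squeezed between `R` and `x`, which have the same union.
  have hB : B ξ = D.union x := subset_antisymm (D.union_mono hfcx) (hxR ▸ D.union_mono hRf)
  -- Otherwise `pick ξ` belongs to `x`, hence to `D.union R = B ξ`.
  have hAB : A ⊆ B ξ := by
    by_contra h
    obtain ⟨hpA, hpB⟩ := hpick ξ h
    have : pick ξ ∈ x := hcl ξ hξ.1 ξ hξ.1 ξ hξ.1 _ (Or.inl (by simp)) hpA
    exact hpB (hB ▸ hxR ▸ hxsub this)
  have hxL : x ⊆ Iio lam.ord := hxA.1.trans hA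
  have hcov : B ξ ⊆ ⋃ a ∈ D.Q (B ξ), D.P a := by
    rw [hB]
    refine D.subset_Q _ (D.union_subset hxL) (D.mk_union_le (hκ'.le.trans hκμ) hxL ?_)
    exact hxA.2.le.trans (lift_le.2 hκμ)
  refine hcap ⟨fun a ha => ?_, fun b hb a ha hab => ?_⟩
  · obtain ⟨q, hq, haq⟩ := mem_iUnion₂.1 (hcov (hAB (hxA.1 ha)))
    have hm := D.g_mem q (D.Q_subset _ hq) a haq
    rw [← hB]
    exact ⟨q, hq, haq, hcl ξ hξ.1 a ha a ha _ (Or.inr (Or.inl ⟨q, hq, rfl⟩)) (hμA hm), hm⟩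
  · rw [← hB] at ha
    obtain ⟨q, hq, haq, hη⟩ := ha
    exact hcl ξ hξ.1 b hb _ hη.1 _ (Or.inr (Or.inr ⟨q, hq, a, haq, hab, rfl, rfl⟩))
      (hμA (D.g_mem b (hxL hb) a hab))

end CoverSystem

/-! ### Games of countable length and undefeated positions -/

section ClosedGame

variable {X E : Type*}

/-- The positions reached by a run up to and including stage `n`. -/
def history (r : ℕ → X) (n : ℕ) : List X := (List.range (n + 1)).map r

theorem history_succ (r : ℕ → X) (n : ℕ) : history r (n + 1) = history r n ++ [r (n + 1)] := by
  simp [history, List.range_succ]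

theorem history_succ_eq_cons (r : ℕ → X) (n : ℕ) :
    history r (n + 1) = r 0 :: history (fun k => r (k + 1)) n := by
  simp [history, List.range_succ_eq_map (n := n + 1), Function.comp_def]

theorem getLastD_history (r : ℕ → X) (n : ℕ) (a : X) : (history r n).getLastD a = r n := by
  cases n with
  | zero => simp [history]
  | succ n => simp [history_succ]

theorem exists_run_of_next (x : X) (next : List X → X) :
    ∃ r : ℕ → X, r 0 = x ∧ ∀ n, r (n + 1) = next (history r n) := by
  let h : ℕ → List X := fun n => Nat.rec [x] (fun _ l => l ++ [next l]) n
  let r : ℕ → X := fun n => Nat.casesOn n x fun k => next (h k)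
  have hr : ∀ n, history r n = h n := by
    intro n
    induction n with
    | zero => simp [history, h, r]
    | succ n ih => rw [history_succ, ih]
  exact ⟨r, rfl, fun n => by rw [hr]⟩

/-- In the game in which the first player poses demands and the second player answers them by
moves along `step`, no strategy of the first player beats all runs starting at `x`. -/
def Undefeated (step : X → X → Prop) (meets : E → X → Prop) (x : X) : Prop :=
  ∀ s : List X → E, ∃ r : ℕ → X, r 0 = x ∧ (∀ n, step (r n) (r (n + 1))) ∧
    ∀ n, meets (s (history r n)) (r (n + 1))

theorem Undefeated.exists_step {step : X → X → Prop} {meets : E → X → Prop} {x : X}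
    (hx : Undefeated step meets x) (d : E) :
    ∃ y, step x y ∧ meets d y ∧ Undefeated step meets y := by
  by_contra hcon
  have hs : ∀ y, ∃ s : List X → E, step x y → meets d y →
      ∀ r : ℕ → X, r 0 = y → (∀ n, step (r n) (r (n + 1))) →
        ¬ ∀ n, meets (s (history r n)) (r (n + 1)) := by
    intro y
    by_cases hy : step x y ∧ meets d y
    · have : ¬ Undefeated step meets y := fun h => hcon ⟨y, hy.1, hy.2, h⟩
      simp only [Undefeated, not_forall] at this
      obtain ⟨s, hs⟩ := this
      exact ⟨s, fun _ _ r h0 h1 h2 => hs ⟨r, h0, h1, h2⟩⟩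
    · exact ⟨fun _ => d, fun h1 h2 => absurd ⟨h1, h2⟩ hy⟩
  choose s hs using hs
  -- Glued strategy: open with `d`, then follow the strategy that beats the answer `y`, dropping the
  -- initial position from the history.
  obtain ⟨r, h0, h1, h2⟩ := hx fun l => match l with
    | _ :: y :: t => s y (y :: t)
    | _ => d
  refine hs (r 1) (h0 ▸ h1 0) ?_ (fun n => r (n + 1)) rfl (fun n => h1 (n + 1)) fun n => ?_
  · simpa [history] using h2 0
  · have := h2 (n + 1)
    rw [history_succ_eq_cons] at this
    cases n with
    | zero => simpa [history] using this
    | succ n =>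
      rw [history_succ_eq_cons] at this ⊢
      exact this

end ClosedGame

/-! ### Legal positions -/

theorem union_eq_iUnion_union_finset {α : Type v} (R z : Set α) :
    R ∪ z = ⋃ e : {e : Finset α // (e : Set α) ⊆ z}, (R ∪ (e.1 : Set α)) := by
  refine subset_antisymm (Set.union_subset ?_ fun a ha => ?_) (iUnion_subset fun e =>
    union_subset_union_right R e.2)
  · exact subset_iUnion_of_subset ⟨∅, by simp⟩ subset_union_left
  · exact mem_iUnion.2 ⟨⟨{a}, by simpa using ha⟩, Or.inr (by simp)⟩

/-- Adding `R` to `z` and closing under `G` does not add new elements of `m` to `z`. -/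
def Legal (G : Finset Ordinal.{u} → Set Ordinal.{u}) (m z R : Set Ordinal.{u}) : Prop :=
  finClosure G (R ∪ z) ∩ m ⊆ z

theorem Legal.mono {G : Finset Ordinal.{u} → Set Ordinal.{u}} {m z R R' : Set Ordinal.{u}}
    (h : Legal G m z R) (hR : R' ⊆ R) : Legal G m z R' :=
  (inter_subset_inter_left _ (finClosure_mono G (union_subset_union_left z hR))).trans h

theorem Legal.iUnion {G : Finset Ordinal.{u} → Set Ordinal.{u}} {m z : Set Ordinal.{u}}
    {r : ℕ → Set Ordinal.{u}} (hr : Monotone r) (h : ∀ n, Legal G m z (r n)) :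
    Legal G m z (⋃ n, r n) := by
  have hm : Monotone fun n => r n ∪ z := fun i j hij => union_subset_union_left z (hr hij)
  rintro a ⟨ha, ham⟩
  rw [iUnion_union] at ha
  obtain ⟨n, hn⟩ := mem_iUnion.1 (finClosure_iUnion_subset G hm.directed_le ha)
  exact h n ⟨hn, ham⟩

/-- The closure of `R ∪ z` is the union of the closures of `R ∪ e` over finite `e ⊆ z`. Legality
thus follows from a closure condition on `z`, which holds on a club of `P_κ μ`. -/
theorem exists_legal {κ μ : Cardinal.{u}} (hκ : κ.IsRegular) (hκ' : ℵ₀ < κ)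
    {G : Finset Ordinal.{u} → Set Ordinal.{u}} (hG : ∀ e, #(G e) < Cardinal.lift.{u + 1, u} κ)
    {T : Set (Set Ordinal.{u})} (hT : IsStationaryIn κ (Iio μ.ord) T) {R : Set Ordinal.{u}}
    (hR : #R < Cardinal.lift.{u + 1, u} κ) : ∃ z ∈ T, Legal G (Iio μ.ord) z R := by
  classical
  have hK : (Cardinal.lift.{u + 1, u} κ).IsRegular := hκ.lift
  have hK' : ℵ₀ < Cardinal.lift.{u + 1, u} κ := by simpa using hκ'
  obtain ⟨z, hzT, -, hz⟩ := hT.2 _ (isClubIn_finClosed (A := Iio μ.ord) hκ hκ'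
    (G := fun e => finClosure G (R ∪ (e : Set Ordinal.{u})) ∩ Iio μ.ord)
    (fun e => inter_subset_right) fun e => by
      refine (mk_le_mk_of_subset inter_subset_left).trans_lt (mk_finClosure_lt hK hK' hG ?_)
      refine (mk_union_le _ _).trans_lt (add_lt_of_lt hK.aleph0_le hR ?_)
      exact (lt_aleph0_of_finite _).trans_le hK.aleph0_le)
  refine ⟨z, hzT, ?_⟩
  rintro a ⟨ha, ham⟩
  have : Nonempty {e : Finset Ordinal.{u} // (e : Set Ordinal.{u}) ⊆ z} := ⟨⟨∅, by simp⟩⟩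
  rw [union_eq_iUnion_union_finset] at ha
  obtain ⟨e, he⟩ := mem_iUnion.1 (finClosure_iUnion_subset G (fun e e' =>
    ⟨⟨e.1 ∪ e'.1, by simpa using ⟨e.2, e'.2⟩⟩,
      union_subset_union_right R (by simp), union_subset_union_right R (by simp)⟩) ha)
  exact hz e.1 e.2 ⟨he, ham⟩

/-! ### The covering game and stationarity -/

namespace CoverSystem

variable {ν μ lam : Cardinal.{u}} (D : CoverSystem ν μ lam)

/-- The moves of the covering game for `z`: legal positions may be extended. -/
def Step (ν μ lam : Cardinal.{u}) (G : Finset Ordinal.{u} → Set Ordinal.{u}) (z : Set Ordinal.{u})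
    (R R' : SmallSubsets ν (Iio lam.ord)) : Prop :=
  R.1 ⊆ R'.1 ∧ Legal G (Iio μ.ord) z R.1 ∧ Legal G (Iio μ.ord) z R'.1

/-- A demand is met by a position if it is covered by the members with index in the position. -/
def Meets (E : SmallSubsets (Order.succ μ) (Iio lam.ord)) (R : SmallSubsets ν (Iio lam.ord)) :
    Prop :=
  E.1 ⊆ D.union R.1

theorem mem_smallSubsets_succ {A x : Set Ordinal.{u}} :
    x ∈ SmallSubsets (Order.succ μ) A ↔ x ⊆ A ∧ #x ≤ Cardinal.lift.{u + 1, u} μ := by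
  rw [SmallSubsets, mem_ofPred, lift_succ, Order.lt_succ_iff]

theorem exists_undefeated {κ : Cardinal.{u}} (hκ : κ.IsRegular) (hκ' : ℵ₀ < κ) (hν : ν.IsRegular)
    (hν' : ℵ₀ < ν) (hνκ : ν < κ) (hκμ : κ ≤ μ)
    {G : Finset Ordinal.{u} → Set Ordinal.{u}} (hG : ∀ e, #(G e) < Cardinal.lift.{u + 1, u} κ)
    {T : Set (Set Ordinal.{u})} (hT : IsStationaryIn κ (Iio μ.ord) T)
    (hTcard : #T = Cardinal.lift.{u + 1, u} μ) (R₀ : SmallSubsets ν (Iio lam.ord)) :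
    ∃ z ∈ T, Undefeated (Step ν μ lam G z) D.Meets R₀ := by
  have hN : (Cardinal.lift.{u + 1, u} ν).IsRegular := hν.lift
  by_contra hcon
  have hs : ∀ z : T, ∃ s : List (SmallSubsets ν (Iio lam.ord)) →
      SmallSubsets (Order.succ μ) (Iio lam.ord), ∀ r : ℕ → SmallSubsets ν (Iio lam.ord),
        r 0 = R₀ → (∀ n, Step ν μ lam G z (r n) (r (n + 1))) →
          ¬ ∀ n, D.Meets (s (history r n)) (r (n + 1)) := by
    intro z
    have : ¬ Undefeated (Step ν μ lam G z) D.Meets R₀ := fun h => hcon ⟨z, z.2, h⟩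
    simp only [Undefeated, not_forall] at this
    obtain ⟨s, hs⟩ := this
    exact ⟨s, fun r h0 h1 h2 => hs ⟨r, h0, h1, h2⟩⟩
  choose s hs using hs
  -- The pooled demand of all strategies still has size at most `μ`, because `T` has size `μ`.
  let E : List (SmallSubsets ν (Iio lam.ord)) → Set Ordinal.{u} := fun l => ⋃ z, (s z l).1
  have hEL : ∀ l, E l ⊆ Iio lam.ord := fun l => iUnion_subset fun z => (s z l).2.1
  have hE : ∀ l, #(E l) ≤ Cardinal.lift.{u + 1, u} μ := fun l => by
    have hreg : (Order.succ (Cardinal.lift.{u + 1, u} μ)).IsRegular :=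
      isRegular_succ (by simpa using hκ'.le.trans hκμ)
    rw [← Order.lt_succ_iff]
    refine (card_iUnion_lt_iff_forall_of_isRegular hreg ?_).2 fun z => ?_
    · rw [hTcard]; exact Order.lt_succ _
    · exact Order.lt_succ_iff.2 (mem_smallSubsets_succ.1 (s z l).2).2
  let next : List (SmallSubsets ν (Iio lam.ord)) → SmallSubsets ν (Iio lam.ord) := fun l =>
    ⟨(l.getLastD R₀).1 ∪ D.Q (E l), Set.union_subset (l.getLastD R₀).2.1 (D.Q_subset _),
      (Cardinal.mk_union_le _ _).trans_lt
        (add_lt_of_lt hN.aleph0_le (l.getLastD R₀).2.2 (D.mk_Q_lt _))⟩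
  obtain ⟨r, hr0, hr⟩ := exists_run_of_next R₀ next
  have hr' : ∀ n, (r (n + 1)).1 = (r n).1 ∪ D.Q (E (history r n)) := fun n => by
    rw [hr]
    simp only [next, getLastD_history]
  have hcard : #(⋃ n, (r n).1) < Cardinal.lift.{u + 1, u} ν :=
    mk_iUnion_nat_lt hN (by simpa using hν') fun n => (r n).2.2
  -- The run does not depend on `z`, so `z` can be chosen after it is complete.
  obtain ⟨z, hz, hleg⟩ := exists_legal hκ hκ' hG hT (hcard.trans (lift_lt.2 hνκ))
  have hlegn : ∀ n, Legal G (Iio μ.ord) z (r n).1 := fun n =>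
    hleg.mono (subset_iUnion (fun n => (r n).1) n)
  refine hs ⟨z, hz⟩ r hr0 (fun n => ⟨?_, hlegn n, hlegn (n + 1)⟩) fun n => ?_
  · rw [hr']; exact subset_union_left
  · refine (subset_iUnion (fun z => (s z (history r n)).1) ⟨z, hz⟩).trans
      ((D.subset_Q (E (history r n)) (hEL _) (hE _)).trans (D.union_mono ?_))
    rw [hr']
    exact subset_union_right

/-- The legal limit of a sequence of positions in which each covers the hull of the previous. -/
theorem limit_spec {κ : Cardinal.{u}} (hκ : κ.IsRegular) (hκ' : ℵ₀ < κ) (hν : ν.IsRegular)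
    (hν' : ℵ₀ < ν) (hνκ : ν < κ) (hμlam : μ < lam)
    {G : Finset Ordinal.{u} → Set Ordinal.{u}} (hGL : ∀ e, G e ⊆ Iio lam.ord)
    (hG : ∀ e, #(G e) < Cardinal.lift.{u + 1, u} κ)
    {T : Set (Set Ordinal.{u})} {z : Set Ordinal.{u}} (hz : z ∈ T)
    (hzm : z ∈ SmallSubsets κ (Iio μ.ord))
    {r : ℕ → Set Ordinal.{u}} (hr : ∀ n, r n ∈ SmallSubsets ν (Iio lam.ord)) (hmono : Monotone r)
    (hleg : ∀ n, Legal G (Iio μ.ord) z (r n))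
    (hcl : ∀ n, finClosure G (r n ∪ Iio μ.ord) ⊆ D.union (r (n + 1)))
    (hun : ∀ n, D.union (finClosure G (r n ∪ Iio μ.ord)) ⊆ D.union (r (n + 1))) :
    ∃ x ∈ SmallSubsets κ (Iio lam.ord), FinClosed G x ∧ r 0 ⊆ x ∧ x ∩ Iio μ.ord = z ∧
      D.union x = D.union (⋃ n, r n) ∧ (¬ D.Captured x → x ∈ D.nonreflecting κ T) := by
  have hN : (Cardinal.lift.{u + 1, u} ν).IsRegular := hν.lift
  have hK : (Cardinal.lift.{u + 1, u} κ).IsRegular := hκ.lift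
  have hRL : (⋃ n, r n) ⊆ Iio lam.ord := iUnion_subset fun n => (hr n).1
  have hRc : #(⋃ n, r n) < Cardinal.lift.{u + 1, u} ν :=
    mk_iUnion_nat_lt hN (by simpa using hν') fun n => (hr n).2
  have hmL : Iio μ.ord ⊆ Iio lam.ord := Iio_subset_Iio (ord_le_ord.2 hμlam.le)
  have hx : finClosure G ((⋃ n, r n) ∪ z) ∈ SmallSubsets κ (Iio lam.ord) := by
    refine ⟨finClosure_subset (Set.union_subset hRL (hzm.1.trans hmL)) fun e _ => hGL e, ?_⟩
    refine mk_finClosure_lt hK (by simpa using hκ') hG ((Cardinal.mk_union_le _ _).trans_lt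
      (add_lt_of_lt hK.aleph0_le (hRc.trans (lift_lt.2 hνκ)) hzm.2))
  have hRx : (⋃ n, r n) ⊆ finClosure G ((⋃ n, r n) ∪ z) :=
    subset_union_left.trans (subset_finClosure G _)
  have hxz : finClosure G ((⋃ n, r n) ∪ z) ∩ Iio μ.ord = z :=
    subset_antisymm (Legal.iUnion hmono hleg)
      (subset_inter (subset_union_right.trans (subset_finClosure G _)) hzm.1)
  have hxn : finClosure G ((⋃ n, r n) ∪ z) ⊆ ⋃ n, finClosure G (r n ∪ Iio μ.ord) := by
    have hm : Monotone fun n => r n ∪ z := fun i j hij => union_subset_union_left z (hmono hij)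
    rw [iUnion_union]
    exact (finClosure_iUnion_subset G hm.directed_le).trans
      (iUnion_mono fun n => finClosure_mono G (union_subset_union_right _ hzm.1))
  have hxB : finClosure G ((⋃ n, r n) ∪ z) ⊆ D.union (⋃ n, r n) :=
    hxn.trans (iUnion_subset fun n => (hcl n).trans (D.union_mono (subset_iUnion r (n + 1))))
  have hunion : D.union (finClosure G ((⋃ n, r n) ∪ z)) = D.union (⋃ n, r n) := by
    refine subset_antisymm (iUnion₂_subset fun a ha => ?_) (D.union_mono hRx)
    obtain ⟨n, hn⟩ := mem_iUnion.1 (hxn ha)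
    exact (subset_biUnion_of_mem (u := D.P) hn).trans
      ((hun n).trans (D.union_mono (subset_iUnion r (n + 1))))
  exact ⟨_, hx, finClosed_finClosure G _, (subset_iUnion r 0).trans hRx, hxz, hunion,
    fun hcap => ⟨hx, hxz.symm ▸ hz, ⟨_, hRx, hRc, hunion, hxB⟩, hcap⟩⟩

theorem isStationaryIn_nonreflecting {κ : Cardinal.{u}} (hκ : κ.IsRegular) (hκ' : ℵ₀ < κ)
    (hν : ν.IsRegular) (hν' : ℵ₀ < ν) (hνκ : ν < κ) (hκμ : κ ≤ μ) (hμlam : μ < lam)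
    {T : Set (Set Ordinal.{u})} (hT : IsStationaryIn κ (Iio μ.ord) T)
    (hTcard : #T = Cardinal.lift.{u + 1, u} μ) :
    IsStationaryIn κ (Iio lam.ord) (D.nonreflecting κ T) := by
  refine ⟨fun x hx => hx.1, fun C hC => ?_⟩
  have hmL : Iio μ.ord ⊆ Iio lam.ord := Iio_subset_Iio (ord_le_ord.2 hμlam.le)
  have hM : ℵ₀ ≤ Cardinal.lift.{u + 1, u} μ := by simpa using hκ'.le.trans hκμ
  obtain ⟨G, hGL, hG, hGC⟩ := exists_finClosed_mem_of_isClubIn hκ hC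
  obtain ⟨z, hzT, hz⟩ := D.exists_undefeated hκ hκ' hν hν' hνκ hκμ hG hT hTcard
    ⟨∅, empty_subset _, by simpa using hν.pos⟩
  have hzm := hT.1 hzT
  let W : Set Ordinal.{u} → Prop := fun R => ∃ h : R ∈ SmallSubsets ν (Iio lam.ord),
    Undefeated (Step ν μ lam G z) D.Meets ⟨R, h⟩
  have hW0 : W ∅ := ⟨_, hz⟩
  have hWext : ∀ R, W R → ∀ E ⊆ Iio lam.ord, #E ≤ Cardinal.lift.{u + 1, u} μ →
      ∃ R', R ⊆ R' ∧ E ⊆ D.union R' ∧ W R' := by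
    rintro R ⟨h, hR⟩ E hE hEc
    obtain ⟨R', hstep, hmeet, hR'⟩ := hR.exists_step ⟨E, mem_smallSubsets_succ.2 ⟨hE, hEc⟩⟩
    exact ⟨R'.1, hstep.1, hmeet, R'.2, hR'⟩
  have hWleg : ∀ R, W R → Legal G (Iio μ.ord) z R := by
    rintro R ⟨h, hR⟩
    -- A step includes legality of its starting position, so any demand, here `∅`, reveals it.
    obtain ⟨R', hstep, -⟩ := hR.exists_step
      ⟨∅, mem_smallSubsets_succ.2 ⟨empty_subset _, by simp⟩⟩
    exact hstep.2.1
  -- Otherwise the members indexed by undefeated positions have a union of size at most `μ < lam`,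
  -- and demanding a point outside it is contradictory.
  have hbig : Cardinal.lift.{u + 1, u} μ ≤ #(⋃ R : {R // W R}, R.1) := by
    by_contra hlt
    rw [not_le] at hlt
    have hUL : (⋃ R : {R // W R}, R.1) ⊆ Iio lam.ord := iUnion_subset fun R => R.2.1.1
    have hle := D.mk_union_le (by simpa using hM) hUL hlt.le
    obtain ⟨a, haL, ha⟩ : ∃ a ∈ Iio lam.ord, a ∉ D.union (⋃ R : {R // W R}, R.1) := by
      by_contra hcon
      push Not at hcon
      have h1 := (mk_le_mk_of_subset (show Iio lam.ord ⊆ _ from hcon)).trans hle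
      rw [mk_Iio_ordinal, card_ord, lift_le] at h1
      exact absurd h1 (not_le.2 hμlam)
    obtain ⟨R', -, haR', hR'⟩ := hWext ∅ hW0 {a} (by simpa using haL)
      (by simpa using one_le_aleph0.trans hM)
    exact ha (D.union_mono (subset_iUnion (fun R : {R // W R} => R.1) ⟨R', hR'⟩)
      (haR' (mem_singleton a)))
  obtain ⟨V, hVU, hVc⟩ := le_mk_iff_exists_subset.1 hbig
  obtain ⟨S₀, -, hVS, hS₀⟩ := hWext ∅ hW0 V (hVU.trans (iUnion_subset fun R => R.2.1.1)) hVc.le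
  -- `V` has size `μ`, while the trace has size less than `κ ≤ μ`.
  obtain ⟨a, haV, haS⟩ : ∃ a ∈ V, a ∉ D.trace S₀ z := by
    by_contra hcon
    push Not at hcon
    have h1 := (mk_le_mk_of_subset (show V ⊆ _ from hcon)).trans_lt
      (D.mk_trace_lt hκ hS₀.1.1 (hS₀.1.2.trans (lift_lt.2 hνκ)) hzm.2)
    rw [hVc, lift_lt] at h1
    exact absurd hκμ (not_le.2 h1)
  obtain ⟨⟨R₀, hR₀⟩, haR⟩ := mem_iUnion.1 (hVU haV)
  obtain ⟨b, hbS, hab⟩ := mem_iUnion₂.1 (hVS haV)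
  let H : Set Ordinal.{u} → Set Ordinal.{u} := fun R =>
    finClosure G (R ∪ Iio μ.ord) ∪ D.union (finClosure G (R ∪ Iio μ.ord))
  have hHL : ∀ R, W R → H R ⊆ Iio lam.ord := fun R hR => by
    have : finClosure G (R ∪ Iio μ.ord) ⊆ Iio lam.ord :=
      finClosure_subset (Set.union_subset hR.1.1 hmL) fun e _ => hGL e
    exact Set.union_subset this (D.union_subset this)
  have hHc : ∀ R, W R → #(H R) ≤ Cardinal.lift.{u + 1, u} μ := fun R hR => by
    have hsub : finClosure G (R ∪ Iio μ.ord) ⊆ Iio lam.ord :=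
      finClosure_subset (Set.union_subset hR.1.1 hmL) fun e _ => hGL e
    have hle : #(finClosure G (R ∪ Iio μ.ord)) ≤ Cardinal.lift.{u + 1, u} μ := by
      rw [← Order.lt_succ_iff]
      refine mk_finClosure_lt (isRegular_succ hM) (hM.trans_lt (Order.lt_succ _))
        (fun e => Order.lt_succ_iff.2 ((hG e).le.trans (lift_le.2 hκμ))) ?_
      rw [Order.lt_succ_iff]
      refine (Cardinal.mk_union_le _ _).trans (add_le_of_le hM ?_ ?_)
      · exact hR.1.2.le.trans (lift_le.2 (hνκ.le.trans hκμ))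
      · rw [mk_Iio_ordinal, card_ord]
    exact (Cardinal.mk_union_le _ _).trans
      (add_le_of_le hM hle (D.mk_union_le (by simpa using hM) hsub hle))
  -- Each sequence covers its own hull, as `limit_spec` requires, and the other's, so that the
  -- limits have equal unions.
  have hnext : ∀ p : {R // W R} × {R // W R}, ∃ q : {R // W R} × {R // W R},
      (p.1.1 ⊆ q.1.1 ∧ H p.1.1 ∪ H p.2.1 ⊆ D.union q.1.1) ∧
        p.2.1 ⊆ q.2.1 ∧ H p.1.1 ∪ H p.2.1 ⊆ D.union q.2.1 := by
    rintro ⟨⟨R, hR⟩, ⟨R', hR'⟩⟩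
    have hL := Set.union_subset (hHL R hR) (hHL R' hR')
    have hc := (Cardinal.mk_union_le (H R) (H R')).trans
      (add_le_of_le hM (hHc R hR) (hHc R' hR'))
    obtain ⟨q₁, h1, h2, h3⟩ := hWext R hR _ hL hc
    obtain ⟨q₂, h1', h2', h3'⟩ := hWext R' hR' _ hL hc
    exact ⟨⟨⟨q₁, h3⟩, ⟨q₂, h3'⟩⟩, ⟨h1, h2⟩, h1', h2'⟩
  choose next hnext using hnext
  let p : ℕ → {R // W R} × {R // W R} := fun n => next^[n] ⟨⟨R₀, hR₀⟩, ⟨S₀, hS₀⟩⟩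
  have hp : ∀ n, p (n + 1) = next (p n) := fun n => Function.iterate_succ_apply' next n _
  have hp₁ : ∀ n, H (p n).1.1 ∪ H (p n).2.1 ⊆ D.union (p (n + 1)).1.1 := fun n => by
    rw [hp]; exact (hnext (p n)).1.2
  have hp₂ : ∀ n, H (p n).1.1 ∪ H (p n).2.1 ⊆ D.union (p (n + 1)).2.1 := fun n => by
    rw [hp]; exact (hnext (p n)).2.2
  have hmono₁ : Monotone fun n => (p n).1.1 := monotone_nat_of_le_succ fun n => by
    rw [hp]; exact (hnext (p n)).1.1
  have hmono₂ : Monotone fun n => (p n).2.1 := monotone_nat_of_le_succ fun n => by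
    rw [hp]; exact (hnext (p n)).2.1
  obtain ⟨x, hx, hxG, hRx, hxz, hxU, hxS⟩ := D.limit_spec hκ hκ' hν hν' hνκ hμlam hGL hG hzT hzm
    (fun n => (p n).1.2.1) hmono₁ (fun n => hWleg _ (p n).1.2)
    (fun n => subset_union_left.trans (subset_union_left.trans (hp₁ n)))
    (fun n => subset_union_right.trans (subset_union_left.trans (hp₁ n)))
  obtain ⟨y, hy, hyG, hSy, hyz, hyU, hyS⟩ := D.limit_spec hκ hκ' hν hν' hνκ hμlam hGL hG hzT hzm
    (fun n => (p n).2.2.1) hmono₂ (fun n => hWleg _ (p n).2.2)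
    (fun n => subset_union_left.trans (subset_union_right.trans (hp₂ n)))
    (fun n => subset_union_right.trans (subset_union_right.trans (hp₂ n)))
  have hself : ∀ R : Set Ordinal.{u}, D.union R ⊆ H R := fun R =>
    (D.union_mono (subset_union_left.trans (subset_finClosure G _))).trans subset_union_right
  have hUeq : D.union (⋃ n, (p n).1.1) = D.union (⋃ n, (p n).2.1) := by
    refine subset_antisymm (iUnion₂_subset fun c hc => ?_) (iUnion₂_subset fun c hc => ?_)
    · obtain ⟨n, hn⟩ := mem_iUnion.1 hc
      exact (subset_biUnion_of_mem (u := D.P) hn).trans ((hself _).trans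
        (subset_union_left.trans ((hp₂ n).trans
          (D.union_mono (subset_iUnion (fun n => (p n).2.1) (n + 1))))))
    · obtain ⟨n, hn⟩ := mem_iUnion.1 hc
      exact (subset_biUnion_of_mem (u := D.P) hn).trans ((hself _).trans
        (subset_union_right.trans ((hp₁ n).trans
          (D.union_mono (subset_iUnion (fun n => (p n).1.1) (n + 1))))))
  by_cases hcx : D.Captured x
  · by_cases hcy : D.Captured y
    · exfalso
      -- The trace depends only on the union and on `z`, so it is the same for `x` and `y`.
      have hay : a ∈ D.trace (D.Q (D.union y)) (y ∩ Iio μ.ord) := by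
        rw [hyz, hyU, ← hUeq, ← hxU, ← hxz]
        exact hcx.1 (hRx haR)
      have hby : b ∈ y := hSy hbS
      have hg : D.g b a ∈ y ∩ Iio μ.ord := ⟨hcy.2 b hby a hay hab, D.g_mem b (hy.1 hby) a hab⟩
      exact haS ⟨b, hbS, hab, hyz ▸ hg⟩
    · exact ⟨y, hyS hcy, hGC y hy hyG⟩
  · exact ⟨x, hxS hcx, hGC x hx hxG⟩

end CoverSystem

theorem theorem3 (ν κ μ lam : Cardinal.{u})
    (hν : ν.IsRegular) (hν₁ : ℵ₁ ≤ ν) (hκ : κ.IsRegular) (hνκ : ν < κ)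
    (hκμ : κ ≤ μ) (hμlam : μ < lam)
    (hcov : covNumber lam (Order.succ μ) (Order.succ μ) ν = lam)
    (c : Ordinal.{u} → Set Ordinal.{u})
    (hc : ∀ ξ < μ.ord, c ξ ∈ SmallSubsets ν (Iio μ.ord))
    (T : Set (Set Ordinal.{u})) (hT : IsStationaryIn κ (Iio μ.ord) T)
    (hTcard : #T = Cardinal.lift.{u + 1} μ)
    (hTc : ∀ z ∈ T, IsUnboundedIn (SmallSubsets ν z) (c '' z)) :
    ∃ S : Set (Set Ordinal.{u}), IsNonreflectingStationary κ μ lam S := by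
  have hν' : ℵ₀ < ν := aleph0_lt_aleph_one.trans_le hν₁
  have hκ' : ℵ₀ < κ := hν'.trans hνκ
  obtain ⟨D⟩ := nonempty_coverSystem hν.pos (bot_le.trans_lt hμlam) hcov
  exact ⟨D.nonreflecting κ T,
    D.isStationaryIn_nonreflecting hκ hκ' hν hν' hνκ hκμ hμlam hT hTcard,
    fun A hμA hA hAc => D.not_isStationaryIn_nonreflecting hκ hκ' hνκ hκμ hTc hμA hA hAc⟩
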